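/- **Setting.** Let $n\ge 0$, let $B$ be an oriented smooth $n$-dimensional manifold with corners (Hausdorff, second countable; not assumed compact or connected), $\pi_P:P\to B$ a principal $SL_n(\mathbb Z)$-bundle, $T^n=\mathbb R^n/\mathbb Z^n$, and let $\pi_T:T^n_P=P\times_{SL_n(\mathbb Z)}T^n\to B$ and $\pi_{\mathbb Z}:\mathbb Z^n_P=P\times_{SL_n(\mathbb Z)}\mathbb Z^n\to B$ be the associated bundles. Put $\mathbb R^n_{\ge 0}=\{\xi\in\mathbb R^n:\xi_i\ge 0 \text{ for all } i\}$, $\mu_{\mathbb C^n}(z)=(|z_1|^2,\dots,|z_n|^2)$ and $\nu_{\mathbb C^n}(\xi,\theta)=(\sqrt{\xi_i}\,e^{2\pi\sqrt{-1}\theta_i})_{i}$; $\mathbb R^n$ and $\mathbb C^n$ carry their standard orientations. A *twisted toric manifold* associated with $P$ is an oriented smooth $2n$-dimensional manifold $X$ (Hausdorff, second countable, without boundary) with continuous surjections $\nu:T^n_P\to X$ and $\mu:X\to B$ such that $\mu\circ\nu=\pi_T$ and every $b\in B$ is the centre of a *locally toric chart* $(U,\varphi^P,\varphi^X,\varphi^B)$,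 that is: * $U$ is an open neighbourhood of $b$ and $\varphi^B$ is an orientation preserving diffeomorphism from $U$ onto $\{\xi\in\mathbb R^n_{\ge 0}:\|\xi-\varphi^B(b)\|<\varepsilon\}$ for some $\varepsilon>0$; * $\varphi^P:\pi_P^{-1}(U)\cong U\times SL_n(\mathbb Z)$ is a local trivialization of $P$; it induces $\varphi^T:\pi_T^{-1}(U)\cong U\times T^n$ and $\varphi^{\mathbb Z}:\pi_{\mathbb Z}^{-1}(U)\cong U\times\mathbb Z^n$; * $\varphi^X:\mu^{-1}(U)\to\mu_{\mathbb C^n}^{-1}(\varphi^B(U))$ is an orientation preserving diffeomorphism with $\varphi^X\circ\nu=\nu_{\mathbb C^n}\circ(\varphi^B\times \mathrm{id}_{T^n})\circ\varphi^T$ on $\pi_T^{-1}(U)$ and $\mu_{\mathbb C^n}\circ\varphi^X=\varphi^B\circ\mu$ on $\mu^{-1}(U)$. For $b\in B$ let $n(b)$ be the number of vanishing coordinates of $b$ in a coordinate system with values in $\mathbb R^n_{\ge 0}$ about $b$, and let $\mathcal S^{(k)}B=\{b\in B: n(b)=n-k\}$. A *rank one sub-lattice bundle* of $\mathbb Z^n_P|_{\mathcal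 S^{(n-1)}B}$ is a subset $\mathcal L\subset\pi_{\mathbb Z}^{-1}(\mathcal S^{(n-1)}B)$ such that every $b\in\mathcal S^{(n-1)}B$ has an open neighbourhood $V$ in $B$ over which a local trivialization of $P$ induces one of $\mathbb Z^n_P$ that maps $\mathcal L|_{V\cap\mathcal S^{(n-1)}B}$ onto $(V\cap\mathcal S^{(n-1)}B)\times L$ for a subgroup $L\subset\mathbb Z^n$ of rank one. It is *primitive* if for every $k$ and every $b\in\mathcal S^{(k)}B$ there are an open neighbourhood $U$ of $b$ for which $U\cap\mathcal S^{(n-1)}B$ has exactly $n-k$ connected components $C_1,\dots,C_{n-k}$, a local trivialization of $P$ over $U$, and vectors $u_1,\dots,u_{n-k}\in\mathbb Z^n$ whose span is a direct summand of $\mathbb Z^n$ of rank $n-k$, such that the induced trivialization of $\mathbb Z^n_P|_U$ maps $\mathcal L|_{C_a}$ onto $C_a\times\mathbb Z u_a$ for $a=1,\dots,n-k$. **Theorem.** For every twisted toric manifold $X$ associated with $\pi_P:P\to B$ there is a primitive rank one sub-lattice bundle $\mathcal L_X$ of $\mathbb Z^n_P|_{\mathcal S^{(n-1)}B}$ such that,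 in every locally toric chart $(U,\varphi^P,\varphi^X,\varphi^B)$ of $X$ and for every $i$, the fibre of $\mathcal L_X$ over each point $b\in U\cap\mathcal S^{(n-1)}B$ with $\varphi^B(b)_i=0$ is mapped by $\varphi^{\mathbb Z}$ onto $\mathbb Z e_i$, where $e_i$ is the $i$-th standard basis vector of $\mathbb Z^n$. It is uniquely determined by $X$: if $\mathcal A$ is any family of locally toric charts of $X$ whose domains cover $\mathcal S^{(n-1)}B$, then $\mathcal L_X$ is the only rank one sub-lattice bundle of $\mathbb Z^n_P|_{\mathcal S^{(n-1)}B}$ that has this property in all charts of $\mathcal A$. ($\mathcal L_X$ is called the characteristic bundle of $X$.) -/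

import Mathlib

open scoped Manifold ContDiff Topology

noncomputable section

namespace TwistedToric

/-! ### Oriented manifolds (possibly with boundary and corners) -/

section Orientation

variable {E H E' : Type*} [NormedAddCommGroup E] [NormedSpace ℝ E] [TopologicalSpace H]
  [NormedAddCommGroup E'] [NormedSpace ℝ E']
  (I : ModelWithCorners ℝ E H) {M : Type*} [TopologicalSpace M] [ChartedSpace H M]

/-- The map `f` from a manifold with oriented tangent spaces to a vector space with orientation `o`
is orientation preserving at `x`: its derivative at `x` is a linear isomorphism that carries the
orientation of the tangent space at `x` to `o`. -/
def PreservesOrientationAt {ι : Type*} (oM : ∀ x : M, Orientation ℝ (TangentSpace I x) ι)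
    (o : Orientation ℝ E' ι) (f : M → E') (x : M) : Prop :=
  ∃ e : TangentSpace I x ≃L[ℝ] E',
    (e : TangentSpace I x →L[ℝ] E') = mfderiv I 𝓘(ℝ, E') f x ∧
      Orientation.map ι e.toLinearEquiv (oM x) = o

variable (M) in
/-- An orientation of a manifold: a choice of orientations of the tangent spaces which is locally
constant when it is read in the preferred charts. (The index type `ι` has as many elements as the
dimension of the manifold in all uses.) -/
structure ManifoldOrientation (ι : Type*) where
  /-- The orientation of each tangent space. -/
  at_ : ∀ x : M, Orientation ℝ (TangentSpace I x) ι
  locally_constant : ∀ x₀ : M, ∃ o₀ : Orientation ℝ E ι, ∀ᶠ x in 𝓝 x₀,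
    PreservesOrientationAt I at_ o₀ (extChartAt I x₀) x

/-- A homeomorphism between an open subset of a manifold and an open subset of a vector space is a
(smooth) diffeomorphism. -/
def IsDiffeo (φ : OpenPartialHomeomorph M E') : Prop :=
  ContMDiffOn I 𝓘(ℝ, E') ∞ φ φ.source ∧ ContMDiffOn 𝓘(ℝ, E') I ∞ φ.symm φ.target

end Orientation

/-! ### The action of `SL(n, ℤ)` on `ℤⁿ` and on the torus `Tⁿ = (ℝ/ℤ)ⁿ` -/

/-- The group `SL_n(ℤ)`; it carries the discrete topology. -/
abbrev SLZ (n : ℕ) : Type := Matrix.SpecialLinearGroup (Fin n) ℤ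

/-- The natural left action of `SL_n(ℤ)` on `Aⁿ`, for an abelian group `A`, by multiplication of a
matrix with a column vector; used for `A = ℤ` and for `A = ℝ/ℤ`. -/
def slAct {n : ℕ} {A : Type*} [AddCommGroup A] (g : SLZ n) (v : Fin n → A) : Fin n → A :=
  fun i => ∑ j, (g : Matrix (Fin n) (Fin n) ℤ) i j • v j

theorem slAct_one {n : ℕ} {A : Type*} [AddCommGroup A] (v : Fin n → A) :
    slAct (1 : SLZ n) v = v := by
  funext i
  simp [slAct, Matrix.one_apply, ite_smul]

theorem slAct_mul {n : ℕ} {A : Type*} [AddCommGroup A] (g h : SLZ n) (v : Fin n → A) :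
    slAct (g * h) v = slAct g (slAct h v) := by
  funext i
  simp only [slAct, Matrix.SpecialLinearGroup.coe_mul, Matrix.mul_apply, Finset.sum_smul,
    Finset.smul_sum, mul_smul]
  exact Finset.sum_comm

/-! ### Principal `SL_n(ℤ)`-bundles and associated bundles -/

section Bundles

variable {n : ℕ} {B P : Type*} [TopologicalSpace B] [TopologicalSpace P]
  [MulAction (SLZ n)ᵐᵒᵖ P]

/-- A local trivialization `φ : π⁻¹(U) ≅ U × SL_n(ℤ)` of `π : P → B`, equivariant for the right
actions of `SL_n(ℤ)`. A right action of `SL_n(ℤ)` is an action of the opposite group: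
`MulOpposite.op g • p` is `p · g`. -/
structure LocalTrivialization (π : P → B) where
  triv : Bundle.Trivialization (SLZ n) π
  equivariant : ∀ (p : P) (g : SLZ n), π p ∈ triv.baseSet →
    (triv (MulOpposite.op g • p)).2 = (triv p).2 * g

variable (n B P) in
/-- A principal `SL_n(ℤ)`-bundle `π_P : P → B`. -/
structure PrincipalSLBundle where
  proj : P → B
  continuous_smul : ∀ g : SLZ n, Continuous fun p : P => MulOpposite.op g • p
  proj_smul : ∀ (p : P) (g : SLZ n), proj (MulOpposite.op g • p) = proj p
  exists_triv : ∀ b : B, ∃ φ : LocalTrivialization (n := n) proj, b ∈ φ.triv.baseSet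

variable (n P) in
/-- The equivalence relation `(p · g, v) ∼ (p, g v)` on `P × Aⁿ`. -/
def assocSetoid (A : Type*) [AddCommGroup A] : Setoid (P × (Fin n → A)) where
  r x y := ∃ g : SLZ n, x.1 = MulOpposite.op g • y.1 ∧ y.2 = slAct g x.2
  iseqv :=
    { refl := fun x => ⟨1, by simp, (slAct_one _).symm⟩
      symm := by
        rintro ⟨p, v⟩ ⟨q, w⟩ ⟨g, h1, h2⟩
        refine ⟨g⁻¹, ?_, ?_⟩
        · simp only at h1
          simp [h1, smul_smul]
        · simp only at h2
          simp [h2, ← slAct_mul, slAct_one]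
      trans := by
        rintro ⟨p, v⟩ ⟨q, w⟩ ⟨r, u⟩ ⟨g, h1, h2⟩ ⟨h, h3, h4⟩
        refine ⟨h * g, ?_, ?_⟩
        · simp only at h1 h3
          simp [h1, h3, smul_smul, ← MulOpposite.op_mul]
        · simp only at h2 h4
          simp [h2, h4, slAct_mul] }

variable (n P) in
/-- The total space `P ×_{SL_n(ℤ)} Aⁿ` of the bundle associated with `P`, with the quotient
topology. `Assoc n P UnitAddCircle` is the torus bundle `T^n_P`, and `Assoc n P ℤ` is the lattice
bundle `ℤ^n_P`. -/
def Assoc (A : Type*) [AddCommGroup A] : Type _ := Quotient (assocSetoid n P A)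

instance (A : Type*) [AddCommGroup A] [TopologicalSpace A] : TopologicalSpace (Assoc n P A) :=
  inferInstanceAs (TopologicalSpace (Quotient (assocSetoid n P A)))

/-- The projection of the associated bundle to `B`. -/
def PrincipalSLBundle.assocProj (𝔓 : PrincipalSLBundle n B P) {A : Type*} [AddCommGroup A] :
    Assoc n P A → B :=
  Quotient.lift (fun x : P × (Fin n → A) => 𝔓.proj x.1) (by
    rintro ⟨p, v⟩ ⟨q, w⟩ ⟨g, h1, -⟩
    simp only at h1
    simp [h1, 𝔓.proj_smul])

open Classical in
/-- The fibre coordinate `[p, v] ↦ φ(p)₂ v` of the local trivialization of the associated bundle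
that is induced by a local trivialization `φ` of `P` over `U` (and `0` for points not over `U`). -/
def LocalTrivialization.assocCoord (𝔓 : PrincipalSLBundle n B P)
    (φ : LocalTrivialization (n := n) 𝔓.proj) {A : Type*} [AddCommGroup A] :
    Assoc n P A → (Fin n → A) :=
  Quotient.lift (fun x : P × (Fin n → A) =>
    if 𝔓.proj x.1 ∈ φ.triv.baseSet then slAct (φ.triv x.1).2 x.2 else 0) (by
    rintro ⟨p, v⟩ ⟨q, w⟩ ⟨g, h1, h2⟩
    simp only at h1 h2
    subst h1 h2
    simp only [𝔓.proj_smul]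
    split_ifs with h
    · rw [φ.equivariant q g h, slAct_mul]
    · rfl)

end Bundles

/-! ### Manifolds with corners, strata, and the local model -/

/-- The model of `n`-dimensional manifolds with corners, `𝔱*_{≥0} = {ξ ∈ ℝⁿ | ξ_i ≥ 0}`. -/
abbrev cornerModel (n : ℕ) :
    ModelWithCorners ℝ (EuclideanSpace ℝ (Fin n)) (EuclideanQuadrant n) :=
  modelWithCornersEuclideanQuadrant n

section Strata

variable (n : ℕ) {B : Type*} [TopologicalSpace B] [ChartedSpace (EuclideanQuadrant n) B]

/-- `n(b)`: the number of coordinates of `b` that vanish, in a coordinate system about `b`. -/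
def depth (b : B) : ℕ :=
  (Finset.univ.filter fun i : Fin n => (chartAt (EuclideanQuadrant n) b b).1 i = 0).card

variable (B) in
/-- The stratum of codimension `c`, that is, `𝒮^{(n-c)}B`. -/
def codimStratum (c : ℕ) : Set B := {b | depth n b = c}

end Strata

/-- The standard orientation of `𝔱* = ℝⁿ`. -/
def stdOrientation (n : ℕ) : Orientation ℝ (EuclideanSpace ℝ (Fin n)) (Fin n) :=
  (EuclideanSpace.basisFun (Fin n) ℝ).toBasis.orientation

/-- The standard orientation of `ℂⁿ`, in which `(1, i, 1, i, …)` is a positive basis, with the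
index `⟨k, 0⟩` for the real part and `⟨k, 1⟩` for the imaginary part of the `k`-th coordinate. -/
def stdComplexOrientation (n : ℕ) : Orientation ℝ (Fin n → ℂ) (Σ _ : Fin n, Fin 2) :=
  (Pi.basis fun _ : Fin n => Complex.basisOneI).orientation

/-- The map `μ_{ℂⁿ}(z) = (|z_1|², …, |z_n|²)`. -/
def momentMap (n : ℕ) (z : Fin n → ℂ) : EuclideanQuadrant n :=
  ⟨WithLp.toLp 2 fun i => ‖z i‖ ^ 2, fun i => by positivity⟩

/-- The map `ν_{ℂⁿ}(ξ, θ) = (√ξ_i e^{2π√-1 θ_i})_i`. -/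
def nuModel (n : ℕ) (ξ : EuclideanQuadrant n) (θ : Fin n → UnitAddCircle) : Fin n → ℂ :=
  fun i => (Real.sqrt (ξ.1 i) : ℂ) * ((AddCircle.toCircle (θ i) : Circle) : ℂ)

/-! ### Twisted toric manifolds -/

section Toric

variable {n : ℕ} {B P X : Type*}
  [TopologicalSpace B] [ChartedSpace (EuclideanQuadrant n) B]
  [TopologicalSpace P] [MulAction (SLZ n)ᵐᵒᵖ P]
  [TopologicalSpace X] [ChartedSpace (EuclideanSpace ℝ (Fin (2 * n))) X]

/-- A locally toric chart `(U, φ^P, φ^X, φ^B)` about a point `center`, for maps `ν : T^n_P → X` and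
`μ : X → B`. Here `U = φB.source`. -/
structure LocallyToricChart (𝔓 : PrincipalSLBundle n B P)
    (oB : ManifoldOrientation (cornerModel n) B (Fin n))
    (oX : ManifoldOrientation (𝓡 (2 * n)) X (Σ _ : Fin n, Fin 2))
    (ν : Assoc n P UnitAddCircle → X) (μ : X → B) where
  center : B
  radius : ℝ
  radius_pos : 0 < radius
  /-- The coordinate system `φ^B : U ≅ 𝔱*_{≥0} ∩ D_ε(ξ₀)`, a diffeomorphism, with
  `ξ₀ = φ^B(center)`. -/
  φB : OpenPartialHomeomorph B (EuclideanQuadrant n)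
  φB_smooth : φB ∈ IsManifold.maximalAtlas (cornerModel n) ∞ B
  φB_orientation : ∀ b ∈ φB.source,
    PreservesOrientationAt (cornerModel n) oB.at_ (stdOrientation n) (fun b' => (φB b').1) b
  center_mem : center ∈ φB.source
  φB_target : φB.target = {ξ | dist ξ.1 (φB center).1 < radius}
  /-- The local trivialization `φ^P` of `P` over `U`. -/
  φP : LocalTrivialization (n := n) 𝔓.proj
  φP_baseSet : φP.triv.baseSet = φB.source
  /-- The diffeomorphism `φ^X : μ⁻¹(U) ≅ μ_{ℂⁿ}⁻¹(D_ε(ξ₀))`. -/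
  φX : OpenPartialHomeomorph X (Fin n → ℂ)
  φX_source : φX.source = μ ⁻¹' φB.source
  φX_target : φX.target = momentMap n ⁻¹' φB.target
  φX_diffeo : IsDiffeo (𝓡 (2 * n)) φX
  φX_orientation : ∀ x ∈ φX.source,
    PreservesOrientationAt (𝓡 (2 * n)) oX.at_ (stdComplexOrientation n) φX x
  comm_ν : ∀ t : Assoc n P UnitAddCircle, 𝔓.assocProj t ∈ φB.source →
    φX (ν t) = nuModel n (φB (𝔓.assocProj t)) (φP.assocCoord 𝔓 t)
  comm_μ : ∀ x : X, μ x ∈ φB.source → momentMap n (φX x) = φB (μ x)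

/-- A `2n`-dimensional twisted toric manifold `(X, ν, μ)` associated with the principal
`SL_n(ℤ)`-bundle `P → B`, for an oriented `2n`-dimensional manifold `X` and an oriented
`n`-dimensional manifold `B` with corners. -/
structure TwistedToricManifold (𝔓 : PrincipalSLBundle n B P)
    (oB : ManifoldOrientation (cornerModel n) B (Fin n))
    (oX : ManifoldOrientation (𝓡 (2 * n)) X (Σ _ : Fin n, Fin 2)) where
  ν : Assoc n P UnitAddCircle → X
  μ : X → B
  continuous_ν : Continuous ν
  continuous_μ : Continuous μ
  surjective_ν : Function.Surjective ν
  surjective_μ : Function.Surjective μ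
  comm : ∀ t : Assoc n P UnitAddCircle, μ (ν t) = 𝔓.assocProj t
  exists_chart : ∀ b : B, ∃ c : LocallyToricChart 𝔓 oB oX ν μ, c.center = b

/-! ### Rank one sub-lattice bundles -/

/-- A tuple of rank one sub-lattices of `ℤⁿ` is primitive if the `L_a` are spanned by vectors `u_a`
whose span is a direct summand of `ℤⁿ` of rank `k`. -/
def IsPrimitiveTuple {k : ℕ} (L : Fin k → Submodule ℤ (Fin n → ℤ)) : Prop :=
  ∃ u : Fin k → (Fin n → ℤ),
    Module.finrank ℤ (Submodule.span ℤ (Set.range u)) = k ∧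
    (∃ Q : Submodule ℤ (Fin n → ℤ), IsCompl (Submodule.span ℤ (Set.range u)) Q) ∧
    ∀ a, L a = Submodule.span ℤ {u a}

/-- A rank one sub-lattice bundle of the restriction of the lattice bundle `ℤ^n_P` to the
codimension one stratum `𝒮^{(n-1)}B`: a subset of `ℤ^n_P` lying over the stratum that near each
point of the stratum becomes a product with a fixed rank one sub-lattice of `ℤⁿ` in a local
trivialization of `ℤ^n_P` induced by one of `P`. -/
@[ext]
structure RankOneSublatticeBundle (𝔓 : PrincipalSLBundle n B P) where
  carrier : Set (Assoc n P ℤ)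
  proj_mem : ∀ x ∈ carrier, 𝔓.assocProj x ∈ codimStratum n B 1
  locally_trivial : ∀ b ∈ codimStratum n B 1,
    ∃ (φ : LocalTrivialization (n := n) 𝔓.proj) (L : Submodule ℤ (Fin n → ℤ)),
      b ∈ φ.triv.baseSet ∧ Module.finrank ℤ L = 1 ∧
      ∀ x : Assoc n P ℤ, 𝔓.assocProj x ∈ φ.triv.baseSet ∩ codimStratum n B 1 →
        (x ∈ carrier ↔ φ.assocCoord 𝔓 x ∈ L)

/-- The sub-lattice bundle `ℒ` is primitive: each point `b` of the stratum of codimension `k` has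
an open neighbourhood `U`, the base set of a local trivialization of `P`, such that
`U ∩ 𝒮^{(n-1)}B` has exactly `k` connected components `C_1, …, C_k`, and over `C_a` the bundle `ℒ`
is `C_a × L_a`, for a primitive tuple `(L_1, …, L_k)`. -/
def RankOneSublatticeBundle.IsPrimitive {𝔓 : PrincipalSLBundle n B P}
    (ℒ : RankOneSublatticeBundle 𝔓) : Prop :=
  ∀ (k : ℕ), ∀ b ∈ codimStratum n B k,
    ∃ (U : Set B) (C : Fin k → Set B) (φ : LocalTrivialization (n := n) 𝔓.proj)
      (L : Fin k → Submodule ℤ (Fin n → ℤ)),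
      IsOpen U ∧ b ∈ U ∧ Function.Injective C ∧
      Set.range C = {D | ∃ x ∈ U ∩ codimStratum n B 1,
        D = connectedComponentIn (U ∩ codimStratum n B 1) x} ∧
      φ.triv.baseSet = U ∧ IsPrimitiveTuple L ∧
      ∀ (a : Fin k) (x : Assoc n P ℤ), 𝔓.assocProj x ∈ C a →
        (x ∈ ℒ.carrier ↔ φ.assocCoord 𝔓 x ∈ L a)

/-- In the locally toric chart `c`, the sub-lattice bundle `ℒ` is the trivial bundle with fibre
`ℤ e_i` over the part of the codimension one stratum on which the `i`-th coordinate vanishes. -/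
def RankOneSublatticeBundle.IsStandardIn {𝔓 : PrincipalSLBundle n B P}
    (ℒ : RankOneSublatticeBundle 𝔓)
    {oB : ManifoldOrientation (cornerModel n) B (Fin n)}
    {oX : ManifoldOrientation (𝓡 (2 * n)) X (Σ _ : Fin n, Fin 2)}
    {ν : Assoc n P UnitAddCircle → X} {μ : X → B}
    (c : LocallyToricChart 𝔓 oB oX ν μ) : Prop :=
  ∀ (i : Fin n) (x : Assoc n P ℤ),
    𝔓.assocProj x ∈ c.φB.source ∩ codimStratum n B 1 →
    (c.φB (𝔓.assocProj x)).1 i = 0 →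
    (x ∈ ℒ.carrier ↔
      c.φP.assocCoord 𝔓 x ∈ Submodule.span ℤ {(Pi.single i 1 : Fin n → ℤ)})

end Toric

end TwistedToric

end

/-! The lattice bundle can be read off from `ν` alone. A lattice vector `[p, v]` over a point of the
codimension one stratum belongs to it when the circle `s ↦ [p, s v]` in the torus fibre is collapsed
to a point of `X`. In a locally toric chart, `ν` becomes `(ξ, θ) ↦ (√ξ_i e^{2πiθ_i})`, which forgets
exactly the angles `θ_i` with `ξ_i = 0`. Where only the `i`-th coordinate vanishes, a circle of
direction `v` is therefore collapsed iff the chart sends `v` into `ℤ e_i`. As the description by `ν`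
involves no chart, the lines `ℤ e_i` of different charts agree without any computation of transition
functions; this is `mem_characteristicSet_iff`.

To know that exactly one coordinate vanishes in every such chart, the number of vanishing
coordinates has to be independent of the coordinate system (`depth_eq_zeroCount`). Primitivity
follows because near the centre of a chart the components of the codimension one stratum are the
open faces `ξ_i = 0`, one for each coordinate vanishing at the centre, and they carry distinct
standard basis vectors. Uniqueness holds because the charts of a cover prescribe every fibre over
the stratum. -/

namespace TwistedToric

open Set Filter

/-! ### Invariance of the number of vanishing coordinates -/

section Depth

variable {n : ℕ}

/-- The number of vanishing coordinates of a point of the model of manifolds with corners. -/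
noncomputable def zeroCount (ξ : EuclideanQuadrant n) : ℕ :=
  (Finset.univ.filter fun i : Fin n => ξ.1 i = 0).card

theorem zeroCount_add_card_ne_zero (ξ : EuclideanQuadrant n) :
    zeroCount ξ + Fintype.card {i : Fin n // ξ.1 i ≠ 0} = n := by
  rw [zeroCount, Fintype.card_subtype]
  have := Finset.card_filter_add_card_filter_not (s := (Finset.univ : Finset (Fin n)))
    (fun i => ξ.1 i = 0)
  simpa using this

/-- Moving along a face of the quadrant through `ξ` stays inside the quadrant for a short time. -/
theorem eventually_mem_quadrant (ξ : EuclideanQuadrant n) (v : EuclideanSpace ℝ (Fin n))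
    (hv : ∀ i, ξ.1 i = 0 → v i = 0) :
    ∀ᶠ t : ℝ in 𝓝 0, ∀ i, 0 ≤ (ξ.1 + t • v) i := by
  refine eventually_all.2 fun i => ?_
  rcases eq_or_ne (ξ.1 i) 0 with h | h
  · simp [h, hv i h]
  · have hpos : 0 < ξ.1 i := lt_of_le_of_ne (ξ.2 i) h.symm
    have hc : ContinuousAt (fun t : ℝ => ξ.1 i + t * v i) 0 := by fun_prop
    have := hc.eventually (lt_mem_nhds (a := 0) (by simpa using hpos))
    filter_upwards [this] with t ht
    simpa using ht.le

/-- The derivative of a transition map embeds the tangent space of the open face through `ξ` into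
that of the face through `e ξ`. A line along the first face stays in the quadrant for both signs of
the time, so a coordinate of its image that vanishes at time `0` has a minimum there and zero
derivative. Injectivity comes from differentiating the inverse along the image curve. Comparing
dimensions gives the inequality; its reverse comes from the inverse transition map. -/
theorem zeroCount_le_of_mem_contDiffGroupoid
    {e : OpenPartialHomeomorph (EuclideanQuadrant n) (EuclideanQuadrant n)}
    (he : e ∈ contDiffGroupoid ∞ (cornerModel n)) {ξ : EuclideanQuadrant n}
    (hξ : ξ ∈ e.source) : zeroCount (e ξ) ≤ zeroCount ξ := by
  obtain ⟨hF, hG⟩ := he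
  set I := cornerModel n
  have hIval : ∀ ζ : EuclideanQuadrant n, I ζ = ζ.1 := fun _ => rfl
  have hF' : DifferentiableWithinAt ℝ (I ∘ e ∘ I.symm) (I.symm ⁻¹' e.source ∩ range I) ξ.1 :=
    (ContDiffOn.differentiableOn hF (by simp)) _
      ⟨by rw [← hIval]; simpa using hξ, ⟨ξ, rfl⟩⟩
  have hG' : DifferentiableWithinAt ℝ (I ∘ e.symm ∘ I.symm)
      (I.symm ⁻¹' e.target ∩ range I) (e ξ).1 :=
    (ContDiffOn.differentiableOn hG (by simp)) _
      ⟨by rw [← hIval]; simpa using e.map_source hξ, ⟨e ξ, rfl⟩⟩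
  obtain ⟨A, hA⟩ := hF'
  obtain ⟨A', hA'⟩ := hG'
  have hFξ : (I ∘ e ∘ I.symm) ξ.1 = (e ξ).1 := by
    rw [← hIval ξ]; simp [← hIval]
  have key : ∀ v : EuclideanSpace ℝ (Fin n), (∀ i, ξ.1 i = 0 → v i = 0) →
      (∀ i, (e ξ).1 i = 0 → A v i = 0) ∧ A' (A v) = v := by
    intro v hv
    have hline : HasDerivAt (fun t : ℝ => ξ.1 + t • v) v 0 := by
      simpa using ((hasDerivAt_id (0 : ℝ)).smul_const v).const_add ξ.1
    have hmem : ∀ᶠ t : ℝ in 𝓝 0, ξ.1 + t • v ∈ I.symm ⁻¹' e.source ∩ range I := by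
      have h1 : ∀ᶠ t : ℝ in 𝓝 0, I.symm (ξ.1 + t • v) ∈ e.source := by
        have hc : ContinuousAt (fun t : ℝ => I.symm (ξ.1 + t • v)) 0 :=
          I.continuous_symm.continuousAt.comp hline.continuousAt
        refine hc.eventually (e.open_source.mem_nhds ?_)
        simpa [← hIval] using hξ
      filter_upwards [h1, eventually_mem_quadrant ξ v hv] with t h1 h2
      exact ⟨h1, ⟨⟨_, h2⟩, rfl⟩⟩
    -- The line lies in the domain on a full neighbourhood of `0`, so the derivative within the
    -- domain yields a two-sided derivative along the line.
    have hcurve : HasDerivAt (fun t : ℝ => (I ∘ e ∘ I.symm) (ξ.1 + t • v)) (A v) 0 := by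
      have hA0 : HasFDerivWithinAt (I ∘ e ∘ I.symm) A (I.symm ⁻¹' e.source ∩ range I)
          (ξ.1 + (0 : ℝ) • v) := by simpa using hA
      exact (hA0.comp_hasDerivWithinAt_of_eq (s := {t : ℝ | ξ.1 + t • v ∈
        I.symm ⁻¹' e.source ∩ range I}) 0 hline.hasDerivWithinAt (fun t ht => ht) rfl).hasDerivAt
        hmem
    have hmem' : ∀ᶠ t : ℝ in 𝓝 0,
        (I ∘ e ∘ I.symm) (ξ.1 + t • v) ∈ I.symm ⁻¹' e.target ∩ range I := by
      filter_upwards [hmem] with t ht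
      exact ⟨by simpa using e.map_source ht.1, mem_range_self _⟩
    refine ⟨fun i hi => ?_, ?_⟩
    · have hi' : HasDerivAt (fun t : ℝ => (I ∘ e ∘ I.symm) (ξ.1 + t • v) i) (A v i) 0 :=
        (EuclideanSpace.proj (𝕜 := ℝ) i).hasFDerivAt.comp_hasDerivAt 0 hcurve
      -- The minimum is global: `e` has values in the quadrant even outside its source.
      refine IsLocalMin.hasDerivAt_eq_zero (.of_forall fun t => ?_) hi'
      have h0 : (I ∘ e ∘ I.symm) (ξ.1 + (0 : ℝ) • v) i = 0 := by
        rw [zero_smul, add_zero, hFξ, hi]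
      rw [h0]
      exact (e (I.symm (ξ.1 + t • v))).2 i
    · have hA0 : HasFDerivWithinAt (I ∘ e.symm ∘ I.symm) A' (I.symm ⁻¹' e.target ∩ range I)
          ((I ∘ e ∘ I.symm) (ξ.1 + (0 : ℝ) • v)) := by
        rw [zero_smul, add_zero, hFξ]; exact hA'
      have hback := (hA0.comp_hasDerivWithinAt_of_eq
        (s := {t : ℝ | (I ∘ e ∘ I.symm) (ξ.1 + t • v) ∈ I.symm ⁻¹' e.target ∩ range I}) 0
        hcurve.hasDerivWithinAt (fun t ht => ht) rfl).hasDerivAt hmem'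
      refine hback.unique (hline.congr_of_eventuallyEq ?_)
      filter_upwards [hmem] with t ht
      have h1 : I.symm (ξ.1 + t • v) ∈ e.source := ht.1
      simp [e.left_inv h1, I.right_inv ht.2]
  let ext : ({i : Fin n // ξ.1 i ≠ 0} → ℝ) →ₗ[ℝ] EuclideanSpace ℝ (Fin n) :=
    (WithLp.linearEquiv 2 ℝ (Fin n → ℝ)).symm.toLinearMap ∘ₗ
      Function.ExtendByZero.linearMap ℝ Subtype.val
  have hext : ∀ w i, (h : ξ.1 i ≠ 0) → ext w i = w ⟨i, h⟩ := fun w i h =>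
    Subtype.val_injective.extend_apply w 0 (⟨i, h⟩ : {i : Fin n // ξ.1 i ≠ 0})
  have hext0 : ∀ w i, ξ.1 i = 0 → ext w i = 0 := fun w i h =>
    Function.extend_apply' (f := (Subtype.val : {i : Fin n // ξ.1 i ≠ 0} → Fin n)) w 0 i (by rintro ⟨⟨j, hj⟩, rfl⟩; exact hj h)
  let res : EuclideanSpace ℝ (Fin n) →ₗ[ℝ] ({i : Fin n // (e ξ).1 i ≠ 0} → ℝ) :=
    LinearMap.pi fun i => (EuclideanSpace.proj (𝕜 := ℝ) i.1).toLinearMap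
  -- `ext` parametrizes the tangent space of the face through `ξ`. The coordinates that `res` drops
  -- already vanish on its image under `A`, so no information is lost, and `A'` recovers the vector.
  have hinj : Function.Injective (res ∘ₗ A.toLinearMap ∘ₗ ext) := by
    rw [← LinearMap.ker_eq_bot, LinearMap.ker_eq_bot']
    intro w hw
    obtain ⟨h1, h2⟩ := key (ext w) (hext0 w)
    have hAw : A (ext w) = 0 := by
      ext i
      by_cases h : (e ξ).1 i = 0
      · exact h1 i h
      · exact congrFun hw ⟨i, h⟩
    rw [hAw, map_zero] at h2
    funext i
    rw [← hext w i.1 i.2, ← h2]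
    rfl
  have hcard := LinearMap.finrank_le_finrank_of_injective hinj
  rw [Module.finrank_fintype_fun_eq_card, Module.finrank_fintype_fun_eq_card] at hcard
  have := zeroCount_add_card_ne_zero ξ
  have := zeroCount_add_card_ne_zero (e ξ)
  omega

/-- The depth of a point can be computed in every coordinate system of the smooth structure. -/
theorem depth_eq_zeroCount {B : Type*} [TopologicalSpace B]
    [ChartedSpace (EuclideanQuadrant n) B] [IsManifold (cornerModel n) ∞ B]
    {φ : OpenPartialHomeomorph B (EuclideanQuadrant n)}
    (hφ : φ ∈ IsManifold.maximalAtlas (cornerModel n) ∞ B) {b : B} (hb : b ∈ φ.source) :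
    depth n b = zeroCount (φ b) := by
  -- The inequality is symmetric in the two charts, so using it in both directions gives equality.
  have aux : ∀ {φ ψ : OpenPartialHomeomorph B (EuclideanQuadrant n)},
      φ ∈ IsManifold.maximalAtlas (cornerModel n) ∞ B →
      ψ ∈ IsManifold.maximalAtlas (cornerModel n) ∞ B → b ∈ φ.source → b ∈ ψ.source →
      zeroCount (ψ b) ≤ zeroCount (φ b) := by
    intro φ ψ hφ hψ hb hb'
    have := zeroCount_le_of_mem_contDiffGroupoid (ξ := φ b)
      (IsManifold.compatible_of_mem_maximalAtlas hφ hψ)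
      (by simp [φ.map_source hb, φ.left_inv hb, hb'])
    simpa [φ.left_inv hb] using this
  have hc := IsManifold.chart_mem_maximalAtlas (I := cornerModel n) (n := ∞) b
  have hbc := mem_chart_source (EuclideanQuadrant n) b
  exact le_antisymm (aux hφ hc hb hbc) (aux hc hφ hbc hb)

end Depth

/-! ### The characteristic sub-lattices in a locally toric chart -/

section Characteristic

variable {n : ℕ}

/-- This carries a one-parameter subgroup of the torus to its coordinates in a trivialization, where
its direction is the transformed lattice vector. -/
theorem slAct_coe_mul (g : SLZ n) (s : ℝ) (v : Fin n → ℤ) (i : Fin n) :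
    slAct g (fun j => ((s * v j : ℝ) : UnitAddCircle)) i =
      ((s * (slAct g v i : ℤ) : ℝ) : UnitAddCircle) := by
  simp only [slAct]
  push_cast
  rw [Finset.mul_sum]
  have hsum : ∀ f : Fin n → ℝ, ((∑ j, f j : ℝ) : UnitAddCircle) = ∑ j, (f j : UnitAddCircle) :=
    fun f => map_sum (QuotientAddGroup.mk' (AddSubgroup.zmultiples (1 : ℝ))) f _
  rw [hsum]
  refine Finset.sum_congr rfl fun j _ => ?_
  rw [← AddCircle.coe_zsmul]
  congr 1
  simp only [zsmul_eq_mul, smul_eq_mul]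
  push_cast
  ring

theorem int_eq_zero_of_forall_coe_mul_eq_zero {m : ℤ}
    (h : ∀ s : ℝ, ((s * m : ℝ) : UnitAddCircle) = 0) : m = 0 := by
  by_contra hm
  have hm' : (m : ℝ) ≠ 0 := by exact_mod_cast hm
  -- This `s` makes `s * m` equal to `1 / 2`, which is not an integer.
  obtain ⟨k, hk⟩ := (AddCircle.coe_eq_zero_iff (1 : ℝ)).1 (h (1 / (2 * m)))
  have h2 : (2 * k : ℝ) = 1 := by
    rw [zsmul_eq_mul, mul_one] at hk
    rw [hk]
    field_simp
  have h3 : 2 * k = 1 := by exact_mod_cast h2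
  omega

/-- A zero radius erases the angle; a nonzero radius can be cancelled, and then `AddCircle.toCircle`
is injective. -/
theorem nuModel_eq_nuModel_zero_iff (ξ : EuclideanQuadrant n) (θ : Fin n → UnitAddCircle) :
    nuModel n ξ θ = nuModel n ξ 0 ↔ ∀ i, ξ.1 i ≠ 0 → θ i = 0 := by
  rw [funext_iff]
  refine forall_congr' fun i => ?_
  by_cases h : ξ.1 i = 0
  · simp [nuModel, h]
  · have h0 : ((Real.sqrt (ξ.1 i) : ℝ) : ℂ) ≠ 0 := by
      exact_mod_cast (Real.sqrt_ne_zero (ξ.2 i)).2 h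
    simp only [nuModel, Pi.zero_apply, mul_right_inj' h0, ne_eq, h, not_false_eq_true,
      forall_const, Circle.coe_inj]
    exact (AddCircle.injective_toCircle one_ne_zero).eq_iff

theorem mem_span_single_iff (v : Fin n → ℤ) (i : Fin n) :
    v ∈ Submodule.span ℤ {(Pi.single i 1 : Fin n → ℤ)} ↔ ∀ j, j ≠ i → v j = 0 := by
  rw [Submodule.mem_span_singleton]
  constructor
  · rintro ⟨a, rfl⟩ j hj
    simp [hj]
  · intro h
    refine ⟨v i, ?_⟩
    ext j
    rcases eq_or_ne j i with rfl | hj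
    · simp
    · simp [hj, h j hj]

/-- On the codimension one stratum exactly one coordinate vanishes. -/
theorem zeroCount_eq_one_iff (ξ : EuclideanQuadrant n) :
    zeroCount ξ = 1 ↔ ∃ i, ∀ j, ξ.1 j = 0 ↔ j = i := by
  simp [zeroCount, Finset.card_eq_one, Finset.ext_iff]

section Assoc

variable {B P : Type*} [MulAction (SLZ n)ᵐᵒᵖ P]

/-- The point `[p, v]` of an associated bundle. -/
def assocMk {A : Type*} [AddCommGroup A] (p : P) (v : Fin n → A) : Assoc n P A :=
  Quotient.mk (assocSetoid n P A) (p, v)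

theorem exists_assocMk {A : Type*} [AddCommGroup A] (x : Assoc n P A) :
    ∃ (p : P) (v : Fin n → A), assocMk p v = x := by
  obtain ⟨⟨p, v⟩, rfl⟩ := Quotient.exists_rep x
  exact ⟨p, v, rfl⟩

variable [TopologicalSpace B] [TopologicalSpace P] {𝔓 : PrincipalSLBundle n B P}

theorem assocProj_assocMk (𝔓 : PrincipalSLBundle n B P) {A : Type*} [AddCommGroup A] (p : P)
    (v : Fin n → A) : 𝔓.assocProj (assocMk p v) = 𝔓.proj p := rfl

theorem LocalTrivialization.assocCoord_assocMk (φ : LocalTrivialization (n := n) 𝔓.proj)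
    {A : Type*} [AddCommGroup A] {p : P} (hp : 𝔓.proj p ∈ φ.triv.baseSet) (v : Fin n → A) :
    φ.assocCoord 𝔓 (assocMk p v) = slAct (φ.triv p).2 v :=
  if_pos hp

end Assoc

variable {B P X : Type*}
  [TopologicalSpace B] [ChartedSpace (EuclideanQuadrant n) B]
  [TopologicalSpace P] [MulAction (SLZ n)ᵐᵒᵖ P]
  [TopologicalSpace X] [ChartedSpace (EuclideanSpace ℝ (Fin (2 * n))) X]
  {𝔓 : PrincipalSLBundle n B P}
  {oB : ManifoldOrientation (cornerModel n) B (Fin n)}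
  {oX : ManifoldOrientation (𝓡 (2 * n)) X (Σ _ : Fin n, Fin 2)}

/-- The lattice vectors `[p, v]` over the codimension one stratum for which the circle subgroup
with direction `v` has its orbit through the zero section collapsed to a point by `ν`. -/
def characteristicSet (𝔓 : PrincipalSLBundle n B P) (ν : Assoc n P UnitAddCircle → X) :
    Set (Assoc n P ℤ) :=
  {x | 𝔓.assocProj x ∈ codimStratum n B 1 ∧ ∀ (p : P) (v : Fin n → ℤ), assocMk p v = x →
    ∀ s : ℝ, ν (assocMk p fun j => ((s * v j : ℝ) : UnitAddCircle)) = ν (assocMk p 0)}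

/-- Both points lie over `U`, where `φX` is injective, so their equality can be tested in the model.
-/
theorem LocallyToricChart.ν_eq_ν_iff {ν : Assoc n P UnitAddCircle → X} {μ : X → B}
    (c : LocallyToricChart 𝔓 oB oX ν μ) (hμν : ∀ t, μ (ν t) = 𝔓.assocProj t) {p : P}
    (hp : 𝔓.proj p ∈ c.φB.source) (θ : Fin n → UnitAddCircle) :
    ν (assocMk p θ) = ν (assocMk p 0) ↔
      ∀ i, (c.φB (𝔓.proj p)).1 i ≠ 0 → slAct (c.φP.triv p).2 θ i = 0 := by
  have hsrc : ∀ θ : Fin n → UnitAddCircle, ν (assocMk p θ) ∈ c.φX.source := fun θ => by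
    rw [c.φX_source, mem_preimage, hμν]
    exact hp
  have hp' : 𝔓.proj p ∈ c.φP.triv.baseSet := by rwa [c.φP_baseSet]
  have hzero : slAct (c.φP.triv p).2 (0 : Fin n → UnitAddCircle) = 0 := by
    funext i
    simp [slAct]
  rw [← c.φX.injOn.eq_iff (hsrc θ) (hsrc 0), c.comm_ν (assocMk p θ) hp, c.comm_ν (assocMk p 0) hp,
    c.φP.assocCoord_assocMk hp', c.φP.assocCoord_assocMk hp', hzero]
  exact nuModel_eq_nuModel_zero_iff _ _

variable [IsManifold (cornerModel n) ∞ B]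

theorem mem_codimStratum_iff {ν : Assoc n P UnitAddCircle → X} {μ : X → B}
    (c : LocallyToricChart 𝔓 oB oX ν μ) {b : B} (hb : b ∈ c.φB.source) (k : ℕ) :
    b ∈ codimStratum n B k ↔ zeroCount (c.φB b) = k := by
  rw [← depth_eq_zeroCount c.φB_smooth hb]
  rfl

/-- The heart of the proof. Off the single vanishing index, the transformed vector `w` must satisfy
`s * w j ∈ ℤ` for all real `s`, which forces `w j = 0`. -/
theorem mem_characteristicSet_iff {ν : Assoc n P UnitAddCircle → X} {μ : X → B}
    (c : LocallyToricChart 𝔓 oB oX ν μ) (hμν : ∀ t, μ (ν t) = 𝔓.assocProj t) {i : Fin n}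
    {x : Assoc n P ℤ} (hx : 𝔓.assocProj x ∈ c.φB.source ∩ codimStratum n B 1)
    (hi : (c.φB (𝔓.assocProj x)).1 i = 0) :
    x ∈ characteristicSet 𝔓 ν ↔
      c.φP.assocCoord 𝔓 x ∈ Submodule.span ℤ {(Pi.single i 1 : Fin n → ℤ)} := by
  obtain ⟨k, hk⟩ := (zeroCount_eq_one_iff _).1 ((mem_codimStratum_iff c hx.1 1).1 hx.2)
  obtain rfl := (hk i).1 hi
  -- The right-hand side does not mention the representative, so the condition on all
  -- representatives in `characteristicSet` may be checked on any one of them.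
  have aux : ∀ (p : P) (v : Fin n → ℤ), assocMk p v = x →
      ((∀ s : ℝ, ν (assocMk p fun j => ((s * v j : ℝ) : UnitAddCircle)) = ν (assocMk p 0)) ↔
        c.φP.assocCoord 𝔓 x ∈ Submodule.span ℤ {(Pi.single i 1 : Fin n → ℤ)}) := by
    rintro p v rfl
    rw [assocProj_assocMk] at hx hk
    rw [c.φP.assocCoord_assocMk (by rw [c.φP_baseSet]; exact hx.1), mem_span_single_iff]
    simp only [c.ν_eq_ν_iff hμν hx.1, slAct_coe_mul, ne_eq, hk]
    constructor
    · intro h j hj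
      exact int_eq_zero_of_forall_coe_mul_eq_zero fun s => h s j hj
    · intro h s j hj
      simp [h j hj]
  constructor
  · rintro ⟨-, h⟩
    obtain ⟨p, v, hpv⟩ := exists_assocMk x
    exact (aux p v hpv).1 (h p v hpv)
  · intro h
    exact ⟨hx.2, fun p v hpv => (aux p v hpv).2 h⟩

end Characteristic

/-! ### Faces of small balls in the quadrant -/

section Faces

variable {n : ℕ}

/-- The points of the quadrant at distance less than `δ` from `ξ₀` for which exactly the `i`-th
coordinate vanishes. -/
def openFace (ξ₀ : EuclideanQuadrant n) (δ : ℝ) (i : Fin n) : Set (EuclideanQuadrant n) :=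
  {ξ | dist ξ.1 ξ₀.1 < δ ∧ ∀ j, ξ.1 j = 0 ↔ j = i}

/-- Seen in the ambient vector space, the set is the intersection of a ball with a relatively open
face, hence convex. -/
theorem isPreconnected_openFace (ξ₀ : EuclideanQuadrant n) (δ : ℝ) (i : Fin n) :
    IsPreconnected (openFace ξ₀ δ i) := by
  refine Topology.IsInducing.subtypeVal.isPreconnected_image.1 ?_
  have himage : (Subtype.val '' openFace ξ₀ δ i : Set (EuclideanSpace ℝ (Fin n))) =
      Metric.ball ξ₀.1 δ ∩ {v | v i = 0 ∧ ∀ j, j ≠ i → 0 < v j} := by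
    ext v
    constructor
    · rintro ⟨ξ, ⟨h1, h2⟩, rfl⟩
      exact ⟨h1, (h2 i).2 rfl, fun j hj => lt_of_le_of_ne (ξ.2 j) fun h => hj ((h2 j).1 h.symm)⟩
    · rintro ⟨h1, h2, h3⟩
      have hv : ∀ j, 0 ≤ v j := fun j => by
        rcases eq_or_ne j i with rfl | hj
        · exact h2.ge
        · exact (h3 j hj).le
      refine ⟨⟨v, hv⟩, ⟨h1, fun j => ⟨fun h => ?_, ?_⟩⟩, rfl⟩
      · by_contra hj
        exact (h3 j hj).ne' h
      · rintro rfl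
        exact h2
  change IsPreconnected (Subtype.val '' openFace ξ₀ δ i : Set (EuclideanSpace ℝ (Fin n)))
  rw [himage]
  refine ((convex_ball _ _).inter ?_).isPreconnected
  rintro v ⟨hv, hv'⟩ w ⟨hw, hw'⟩ a b ha hb hab
  refine ⟨by simp [hv, hw], fun j hj => ?_⟩
  have h1 := hv' j hj
  have h2 := hw' j hj
  rcases ha.eq_or_lt with rfl | ha
  · have : b = 1 := by linarith
    simpa [this] using h2
  · have : 0 < a * v j + b * w j := by positivity
    simpa using this

theorem openFace_nonempty {ξ₀ : EuclideanQuadrant n} {δ : ℝ} (hδ : 0 < δ) {i : Fin n}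
    (hi : ξ₀.1 i = 0) : (openFace ξ₀ δ i).Nonempty := by
  -- A short push along `w` makes every coordinate but the `i`-th positive.
  let w : EuclideanSpace ℝ (Fin n) := WithLp.toLp 2 fun j => if j = i then 0 else 1
  have hc : ContinuousAt (fun t : ℝ => ξ₀.1 + t • w) 0 := by fun_prop
  have hball : ∀ᶠ t : ℝ in 𝓝[>] 0, ξ₀.1 + t • w ∈ Metric.ball ξ₀.1 δ :=
    (hc.eventually (Metric.isOpen_ball.mem_nhds (by simpa using hδ))).filter_mono
      nhdsWithin_le_nhds
  obtain ⟨t, ht, ht0⟩ := (hball.and self_mem_nhdsWithin).exists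
  have ht0 : 0 < t := ht0
  have hval : ∀ j, (ξ₀.1 + t • w) j = ξ₀.1 j + if j = i then 0 else t := fun j => by simp [w]
  refine ⟨⟨ξ₀.1 + t • w, fun j => ?_⟩, ht, fun j => ?_⟩
  · rw [hval]
    have := ξ₀.2 j
    split_ifs <;> linarith
  · change (ξ₀.1 + t • w) j = 0 ↔ j = i
    rw [hval]
    have := ξ₀.2 j
    split_ifs with h
    · simp [h, hi]
    · simp only [h, iff_false]
      linarith

/-- In a small ball about `ξ₀` only those coordinates can vanish that vanish at `ξ₀`. -/
theorem exists_radius_forall_ne_zero (ξ₀ : EuclideanQuadrant n) {r : ℝ} (hr : 0 < r) :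
    ∃ δ, 0 < δ ∧ δ ≤ r ∧
      ∀ ξ : EuclideanQuadrant n, dist ξ.1 ξ₀.1 < δ → ∀ i, ξ.1 i = 0 → ξ₀.1 i = 0 := by
  -- A coordinate changes by at most the distance, so `δ` need only be at most `r` and every nonzero
  -- coordinate of `ξ₀`.
  have hev : ∀ᶠ δ : ℝ in 𝓝[>] 0, ∀ i, ξ₀.1 i ≠ 0 → δ ≤ ξ₀.1 i := by
    refine eventually_all.2 fun i => ?_
    by_cases h : ξ₀.1 i = 0
    · simp [h]
    · have hpos : 0 < ξ₀.1 i := lt_of_le_of_ne (ξ₀.2 i) (Ne.symm h)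
      filter_upwards [nhdsWithin_le_nhds (Iic_mem_nhds hpos)] with δ hδ _ using hδ
  obtain ⟨δ, ⟨h1, h2⟩, h3⟩ := ((hev.and (nhdsWithin_le_nhds (Iic_mem_nhds hr))).and
    self_mem_nhdsWithin).exists
  refine ⟨δ, h3, h2, fun ξ hξ i hi => ?_⟩
  by_contra h
  have hle : ‖(ξ.1 - ξ₀.1) i‖ ≤ ‖ξ.1 - ξ₀.1‖ := PiLp.norm_apply_le _ i
  rw [← dist_eq_norm] at hle
  have h4 := h1 i h
  rw [PiLp.sub_apply, hi, zero_sub, norm_neg, Real.norm_eq_abs] at hle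
  have := le_abs_self (ξ₀.1 i)
  linarith

theorem finrank_span_single (i : Fin n) :
    Module.finrank ℤ (Submodule.span ℤ {(Pi.single i 1 : Fin n → ℤ)}) = 1 := by
  have h := (Pi.basisFun ℤ (Fin n)).linearIndependent.comp (fun _ : Unit => i)
    (Function.injective_of_subsingleton _)
  have hrange : range (Pi.basisFun ℤ (Fin n) ∘ fun _ : Unit => i) = {Pi.single i 1} := by
    rw [Function.comp_def, range_const, Pi.basisFun_apply]
  have hrank := finrank_span_eq_card h
  rw [hrange] at hrank
  exact hrank

/-- The remaining standard basis vectors span a complement. -/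
theorem isPrimitiveTuple_single {k : ℕ} {f : Fin k → Fin n} (hf : Function.Injective f) :
    IsPrimitiveTuple fun a => Submodule.span ℤ {(Pi.single (f a) 1 : Fin n → ℤ)} := by
  set e := Pi.basisFun ℤ (Fin n) with he
  have hu : (fun a => (Pi.single (f a) 1 : Fin n → ℤ)) = e ∘ f := by
    funext a
    simp [he]
  refine ⟨fun a => Pi.single (f a) 1, ?_, ⟨Submodule.span ℤ (e '' (range f)ᶜ), ?_⟩, fun a => rfl⟩
  · rw [hu]
    simpa using finrank_span_eq_card (e.linearIndependent.comp f hf)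
  · rw [hu, range_comp]
    refine ⟨e.linearIndependent.disjoint_span_image disjoint_compl_right, ?_⟩
    rw [codisjoint_iff, ← Submodule.span_union, ← image_union, union_compl_self, image_univ,
      e.span_eq]

end Faces

/-- A preconnected subset `W` of `F` is a connected component of `F` if it is cut out of `F` by
an open set whose complement in `F` is relatively open. -/
theorem connectedComponentIn_eq_of_isOpen {α : Type*} [TopologicalSpace α] {F W u v : Set α}
    (hW : IsPreconnected W) (hWF : W ⊆ F) (hu : IsOpen u) (hv : IsOpen v) (hF : F ⊆ u ∪ v)
    (hdisj : F ∩ (u ∩ v) = ∅) (huW : F ∩ u = W) {x : α} (hx : x ∈ W) :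
    connectedComponentIn F x = W := by
  refine Subset.antisymm ?_ (hW.subset_connectedComponentIn hx hWF)
  have hsub := connectedComponentIn_subset F x
  have hxu : x ∈ F ∩ u := huW ▸ hx
  rcases isPreconnected_iff_subset_of_disjoint.1 (isPreconnected_connectedComponentIn (F := F)
    (x := x)) u v hu hv (hsub.trans hF)
    (subset_eq_empty (inter_subset_inter_left _ hsub) hdisj) with h | h
  · rw [← huW]
    exact subset_inter hsub h
  · have hxv := h (mem_connectedComponentIn hxu.1)
    exact absurd (show x ∈ F ∩ (u ∩ v) from ⟨hxu.1, hxu.2, hxv⟩) (by simp [hdisj])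

/-! ### The characteristic bundle -/

section Bundle

variable {n : ℕ} {B P X : Type*}
  [TopologicalSpace B] [TopologicalSpace P] [MulAction (SLZ n)ᵐᵒᵖ P]

/-- The restriction of a local trivialization to a smaller open set. -/
noncomputable def LocalTrivialization.restrOpen {π : P → B} (φ : LocalTrivialization (n := n) π)
    (s : Set B) (hs : IsOpen s) : LocalTrivialization (n := n) π where
  triv := φ.triv.restrOpen s hs
  equivariant p g hp := φ.equivariant p g hp.1

theorem LocalTrivialization.baseSet_restrOpen {π : P → B} (φ : LocalTrivialization (n := n) π)
    {s : Set B} (hs : IsOpen s) (hsub : s ⊆ φ.triv.baseSet) :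
    (φ.restrOpen s hs).triv.baseSet = s :=
  inter_eq_right.2 hsub

/-- The hypothesis `hx` matters: off `s` the restricted coordinate takes its default value `0`. -/
theorem LocalTrivialization.assocCoord_restrOpen {𝔓 : PrincipalSLBundle n B P}
    (φ : LocalTrivialization (n := n) 𝔓.proj) {s : Set B} (hs : IsOpen s)
    (hsub : s ⊆ φ.triv.baseSet) {A : Type*} [AddCommGroup A] {x : Assoc n P A}
    (hx : 𝔓.assocProj x ∈ s) :
    (φ.restrOpen s hs).assocCoord 𝔓 x = φ.assocCoord 𝔓 x := by
  obtain ⟨p, v, rfl⟩ := exists_assocMk x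
  rw [assocProj_assocMk] at hx
  rw [assocCoord_assocMk _ (by rwa [φ.baseSet_restrOpen hs hsub]),
    assocCoord_assocMk _ (hsub hx)]
  rfl

variable [ChartedSpace (EuclideanQuadrant n) B] [IsManifold (cornerModel n) ∞ B]
  [TopologicalSpace X] [ChartedSpace (EuclideanSpace ℝ (Fin (2 * n))) X]
  {𝔓 : PrincipalSLBundle n B P}
  {oB : ManifoldOrientation (cornerModel n) B (Fin n)}
  {oX : ManifoldOrientation (𝓡 (2 * n)) X (Σ _ : Fin n, Fin 2)}

theorem exists_coord_eq_zero {ν : Assoc n P UnitAddCircle → X} {μ : X → B}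
    (c : LocallyToricChart 𝔓 oB oX ν μ) {b : B} (hb : b ∈ c.φB.source)
    (hb1 : b ∈ codimStratum n B 1) : ∃ i, ∀ j, (c.φB b).1 j = 0 ↔ j = i :=
  (zeroCount_eq_one_iff _).1 ((mem_codimStratum_iff c hb 1).1 hb1)

/-- The characteristic bundle of a twisted toric manifold. -/
def characteristicBundle (T : TwistedToricManifold 𝔓 oB oX) : RankOneSublatticeBundle 𝔓 where
  carrier := characteristicSet 𝔓 T.ν
  proj_mem x hx := hx.1
  locally_trivial b hb := by
    obtain ⟨c, rfl⟩ := T.exists_chart b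
    obtain ⟨i, hi⟩ := exists_coord_eq_zero c c.center_mem hb
    -- Shrinking the chart so that only the `i`-th coordinate can vanish leaves a single face of the
    -- stratum, with constant fibre `ℤ e_i`.
    have hopen : IsOpen {ξ : EuclideanQuadrant n | ∀ j, j ≠ i → ξ.1 j ≠ 0} := by
      simp only [ofPred_forall]
      refine isOpen_iInter_of_finite fun j => isOpen_iInter_of_finite fun _ => ?_
      exact isOpen_ne.preimage ((PiLp.continuous_apply 2 _ j).comp continuous_subtype_val)
    have hV := c.φB.isOpen_inter_preimage hopen
    have hsub : c.φB.source ∩ c.φB ⁻¹' {ξ | ∀ j, j ≠ i → ξ.1 j ≠ 0} ⊆ c.φP.triv.baseSet := by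
      rw [c.φP_baseSet]
      exact inter_subset_left
    refine ⟨c.φP.restrOpen _ hV, Submodule.span ℤ {Pi.single i 1}, ?_, finrank_span_single i, ?_⟩
    · rw [c.φP.baseSet_restrOpen hV hsub]
      exact ⟨c.center_mem, fun j hj h => hj ((hi j).1 h)⟩
    · rw [c.φP.baseSet_restrOpen hV hsub]
      intro x hx
      obtain ⟨k, hk⟩ := exists_coord_eq_zero c hx.1.1 hx.2
      have hki : k = i := by
        by_contra h
        exact hx.1.2 k h ((hk k).2 rfl)
      rw [c.φP.assocCoord_restrOpen hV hsub hx.1]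
      exact mem_characteristicSet_iff c T.comm ⟨hx.1.1, hx.2⟩ ((hk i).2 hki.symm)

theorem characteristicBundle_isStandardIn (T : TwistedToricManifold 𝔓 oB oX)
    (c : LocallyToricChart 𝔓 oB oX T.ν T.μ) : (characteristicBundle T).IsStandardIn c :=
  fun _ _ hx hi => mem_characteristicSet_iff c T.comm hx hi

/-- In a ball small enough that no new coordinate vanishes, the stratum is the disjoint union of the
preimages `W i` of the open faces. Those with `ξ₀.1 i = 0` are nonempty and are the components; the
other `W i` are empty. -/
theorem characteristicBundle_isPrimitive (T : TwistedToricManifold 𝔓 oB oX) :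
    (characteristicBundle T).IsPrimitive := by
  intro k b hb
  obtain ⟨c, rfl⟩ := T.exists_chart b
  set ξ₀ := c.φB c.center with hξ₀
  obtain ⟨δ, hδ, hδr, hzero⟩ := exists_radius_forall_ne_zero ξ₀ c.radius_pos
  have hcont : ∀ j, Continuous fun ξ : EuclideanQuadrant n => ξ.1 j := fun j =>
    (PiLp.continuous_apply 2 _ j).comp continuous_subtype_val
  have hball : IsOpen {ξ : EuclideanQuadrant n | dist ξ.1 ξ₀.1 < δ} :=
    isOpen_lt (continuous_subtype_val.dist continuous_const) continuous_const
  set U : Set B := c.φB.source ∩ c.φB ⁻¹' {ξ | dist ξ.1 ξ₀.1 < δ} with hU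
  have hUo : IsOpen U := c.φB.isOpen_inter_preimage hball
  have hsub : U ⊆ c.φP.triv.baseSet := by
    rw [c.φP_baseSet]
    exact inter_subset_left
  let W : Fin n → Set B := fun i => c.φB.source ∩ c.φB ⁻¹' openFace ξ₀ δ i
  have hface : ∀ i, openFace ξ₀ δ i ⊆ c.φB.target := fun i ξ hξ => by
    rw [c.φB_target]
    exact hξ.1.trans_le hδr
  have hWpre : ∀ i, IsPreconnected (W i) := fun i => by
    change IsPreconnected (c.φB.source ∩ c.φB ⁻¹' openFace ξ₀ δ i)
    rw [← c.φB.symm_image_eq_source_inter_preimage (hface i)]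
    exact (isPreconnected_openFace ξ₀ δ i).image _ (c.φB.continuousOn_symm.mono (hface i))
  have hWne : ∀ i, ξ₀.1 i = 0 → (W i).Nonempty := fun i hi => by
    obtain ⟨ξ, hξ⟩ := openFace_nonempty hδ hi
    exact ⟨c.φB.symm ξ, c.φB.map_target (hface i hξ), by
      rw [mem_preimage, c.φB.right_inv (hface i hξ)]; exact hξ⟩
  have hWmem : ∀ {x i}, x ∈ W i → x ∈ U ∩ codimStratum n B 1 := fun {x i} hx =>
    ⟨⟨hx.1, hx.2.1⟩, (mem_codimStratum_iff c hx.1 1).2 ((zeroCount_eq_one_iff _).2 ⟨i, hx.2.2⟩)⟩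
  have hmemW : ∀ {x}, x ∈ U ∩ codimStratum n B 1 → ∃ i, ξ₀.1 i = 0 ∧ x ∈ W i := fun {x} hx => by
    obtain ⟨i, hi⟩ := exists_coord_eq_zero c hx.1.1 hx.2
    exact ⟨i, hzero _ hx.1.2 i ((hi i).2 rfl), hx.1.1, hx.1.2, hi⟩
  have hWinj : ∀ {x i j}, x ∈ W i → x ∈ W j → i = j := fun {x i j} hi hj =>
    (hj.2.2 i).1 ((hi.2.2 i).2 rfl)
  have hcomp : ∀ {x i}, x ∈ W i →
      connectedComponentIn (U ∩ codimStratum n B 1) x = W i := fun {x i} hx => by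
    -- Exactly one coordinate vanishes on the stratum. Hence "no coordinate other than the `i`-th
    -- vanishes" and "the `i`-th does not vanish" are complementary open conditions there, and the
    -- first cuts out `W i`.
    have hu : IsOpen {ξ : EuclideanQuadrant n | ∀ j, j ≠ i → ξ.1 j ≠ 0} := by
      simp only [ofPred_forall]
      exact isOpen_iInter_of_finite fun j => isOpen_iInter_of_finite fun _ =>
        isOpen_ne.preimage (hcont j)
    have hv : IsOpen {ξ : EuclideanQuadrant n | ξ.1 i ≠ 0} := isOpen_ne.preimage (hcont i)
    refine connectedComponentIn_eq_of_isOpen (hWpre i) (fun y hy => hWmem hy)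
      (c.φB.isOpen_inter_preimage hu) (c.φB.isOpen_inter_preimage hv) ?_ ?_ ?_ hx
    · intro y hy
      obtain ⟨j, -, hj⟩ := hmemW hy
      by_cases hij : i = j
      · exact Or.inl ⟨hj.1, fun l hl h => hl (((hj.2.2 l).1 h).trans hij.symm)⟩
      · exact Or.inr ⟨hj.1, fun h => hij ((hj.2.2 i).1 h)⟩
    · refine eq_empty_of_forall_notMem fun y hy => ?_
      obtain ⟨j, -, hj⟩ := hmemW hy.1
      have h0 := (hj.2.2 j).2 rfl
      by_cases hij : j = i
      · exact hy.2.2.2 (hij ▸ h0)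
      · exact hy.2.1.2 j hij h0
    · ext y
      constructor
      · rintro ⟨hy, hy'⟩
        obtain ⟨j, -, hj⟩ := hmemW hy
        have hij : j = i := by
          by_contra hij
          exact hy'.2 j hij ((hj.2.2 j).2 rfl)
        exact hij ▸ hj
      · intro hy
        exact ⟨hWmem hy, hy.1, fun j hj h => hj ((hy.2.2 j).1 h)⟩
  have hcard : Fintype.card {i : Fin n // ξ₀.1 i = 0} = k := by
    rw [Fintype.card_subtype]
    exact (mem_codimStratum_iff c c.center_mem k).1 hb
  -- `σ` enumerates the coordinates vanishing at the centre, and with them the components and their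
  -- basis vectors.
  let σ := (Fintype.equivFinOfCardEq hcard).symm
  refine ⟨U, fun a => W (σ a).1, c.φP.restrOpen U hUo,
    fun a => Submodule.span ℤ {Pi.single (σ a).1 1}, hUo, ⟨c.center_mem, by simpa [← hξ₀]⟩,
    fun a a' h => ?_, ?_, c.φP.baseSet_restrOpen hUo hsub,
    isPrimitiveTuple_single (f := fun a => (σ a).1) (Subtype.val_injective.comp σ.injective),
    fun a x hx => ?_⟩
  · obtain ⟨x, hx⟩ := hWne _ (σ a).2
    have h : W (σ a).1 = W (σ a').1 := h
    exact σ.injective (Subtype.ext (hWinj hx (h ▸ hx)))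
  · ext D
    constructor
    · rintro ⟨a, rfl⟩
      obtain ⟨x, hx⟩ := hWne _ (σ a).2
      exact ⟨x, hWmem hx, (hcomp hx).symm⟩
    · rintro ⟨x, hx, rfl⟩
      obtain ⟨i, hi, hxi⟩ := hmemW hx
      refine ⟨σ.symm ⟨i, hi⟩, ?_⟩
      rw [hcomp hxi]
      simp
  · have hxU := hWmem hx
    rw [c.φP.assocCoord_restrOpen hUo hsub hxU.1]
    exact mem_characteristicSet_iff c T.comm ⟨hx.1, hxU.2⟩ ((hx.2.2 _).2 rfl)

end Bundle

/-- A sub-lattice bundle is determined by being standard in charts that cover the stratum. -/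
theorem RankOneSublatticeBundle.eq_of_isStandardIn {n : ℕ} {B P X : Type*}
    [TopologicalSpace B] [TopologicalSpace P] [MulAction (SLZ n)ᵐᵒᵖ P]
    [ChartedSpace (EuclideanQuadrant n) B] [IsManifold (cornerModel n) ∞ B]
    [TopologicalSpace X] [ChartedSpace (EuclideanSpace ℝ (Fin (2 * n))) X]
    {𝔓 : PrincipalSLBundle n B P}
    {oB : ManifoldOrientation (cornerModel n) B (Fin n)}
    {oX : ManifoldOrientation (𝓡 (2 * n)) X (Σ _ : Fin n, Fin 2)}
    {ν : Assoc n P UnitAddCircle → X} {μ : X → B}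
    {𝒜 : Set (LocallyToricChart 𝔓 oB oX ν μ)}
    (hcover : codimStratum n B 1 ⊆ ⋃ c ∈ 𝒜, c.φB.source)
    {ℒ ℒ' : RankOneSublatticeBundle 𝔓} (h : ∀ c ∈ 𝒜, ℒ.IsStandardIn c)
    (h' : ∀ c ∈ 𝒜, ℒ'.IsStandardIn c) : ℒ = ℒ' := by
  ext x
  by_cases hx : 𝔓.assocProj x ∈ codimStratum n B 1
  · obtain ⟨c, hc, hxc⟩ := mem_iUnion₂.1 (hcover hx)
    obtain ⟨i, hi⟩ := exists_coord_eq_zero c hxc hx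
    rw [h c hc i x ⟨hxc, hx⟩ ((hi i).2 rfl), h' c hc i x ⟨hxc, hx⟩ ((hi i).2 rfl)]
  · exact ⟨fun h => absurd (ℒ.proj_mem x h) hx, fun h => absurd (ℒ'.proj_mem x h) hx⟩

end TwistedToric

theorem theorem5p3 {n : ℕ} {B P X : Type*}
    [TopologicalSpace B] [T2Space B] [SecondCountableTopology B]
    [ChartedSpace (EuclideanQuadrant n) B] [IsManifold (TwistedToric.cornerModel n) ∞ B]
    [TopologicalSpace P] [MulAction (TwistedToric.SLZ n)ᵐᵒᵖ P]
    [TopologicalSpace X] [T2Space X] [SecondCountableTopology X]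
    [ChartedSpace (EuclideanSpace ℝ (Fin (2 * n))) X] [IsManifold (𝓡 (2 * n)) ∞ X]
    (𝔓 : TwistedToric.PrincipalSLBundle n B P)
    (oB : TwistedToric.ManifoldOrientation (TwistedToric.cornerModel n) B (Fin n))
    (oX : TwistedToric.ManifoldOrientation (𝓡 (2 * n)) X (Σ _ : Fin n, Fin 2))
    (T : TwistedToric.TwistedToricManifold 𝔓 oB oX) :
    ∃ ℒ : TwistedToric.RankOneSublatticeBundle 𝔓,
      ℒ.IsPrimitive ∧
      (∀ c : TwistedToric.LocallyToricChart 𝔓 oB oX T.ν T.μ, ℒ.IsStandardIn c) ∧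
      ∀ (𝒜 : Set (TwistedToric.LocallyToricChart 𝔓 oB oX T.ν T.μ)),
        TwistedToric.codimStratum n B 1 ⊆ ⋃ c ∈ 𝒜, c.φB.source →
        ∀ ℒ' : TwistedToric.RankOneSublatticeBundle 𝔓,
          (∀ c ∈ 𝒜, ℒ'.IsStandardIn c) → ℒ' = ℒ := by
  exact ⟨TwistedToric.characteristicBundle T, TwistedToric.characteristicBundle_isPrimitive T,
    TwistedToric.characteristicBundle_isStandardIn T, fun _ hcover _ hℒ' =>
      TwistedToric.RankOneSublatticeBundle.eq_of_isStandardIn hcover hℒ' fun c _ =>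
        TwistedToric.characteristicBundle_isStandardIn T c⟩
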